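/- **Setting.** Let $\mathcal X\subset\mathbb R^d$ be nonempty, convex and compact, with Euclidean projection $\Pi:\mathbb R^d\to\mathcal X$, $\Pi(y)=\arg\min_{x\in\mathcal X}\|y-x\|_2$. Let $\omega$ be a random element with law $P$ on a measurable space $\Xi$, let $F:\mathcal X\times\Xi\to\mathbb R$ be such that $F(x;\omega)$ is integrable for each $x\in\mathcal X$, put $f(x)=\mathbb E[F(x;\omega)]$, and let $\mathcal X^*=\arg\min_{x\in\mathcal X}f(x)$ be the solution set. Distances are Euclidean, $\operatorname{dist}(x,S)=\inf_{z\in S}\|x-z\|_2$, and a sequence $x_n$ converges to a set $S$ if $\operatorname{dist}(x_n,S)\to0$. **Assumptions.** 1. *(Smoothness and moments.)* For $P$-almost every $\omega$, $F(\cdot;\omega)$ is differentiable on $\mathcal X$ with gradient $\nabla F(x;\omega)$ (a gradient relative to $\mathcal X$, jointly measurable in $(x,\omega)$); $\sup_{x\in\mathcal X}\mathbb E\|\nabla F(x;\omega)\|_2^2<\infty$; and $x\mapsto\mathbb E[\nabla F(x;\omega)]$ is Lipschitz on $\mathcal X$. 2. *(Mean variational coherence.)* $\mathbb E[\langle\nabla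 F(x;\omega),x-x^*\rangle]\ge0$ for all $x^*\in\mathcal X^*$ and $x\in\mathcal X$, with equality only if $x\in\mathcal X^*$. 3. *(Delays and step sizes.)* Let $s:\mathbb N\to\mathbb N$ be a deterministic sequence with $s(n)\le n$, where $s(n)$ is the iteration at which the gradient received at iteration $n$ was requested, and let $d_m\in\mathbb N$ bound the delay of the gradients requested at iteration $m$: $n-s(n)\le d_{s(n)}$ for all $n$. Let the step sizes $\alpha_n>0$ ($n\ge1$) be deterministic. One of the following holds (as $n\to\infty$): - (a) $\sup_n d_n<\infty$, $\sum_{n\ge1}\alpha_n^2<\infty$ and $\sum_{n\ge1}\alpha_n=\infty$; - (b) $d_n=O(n^p)$ for some $0<p<1$, and $\alpha_n=\Theta(1/n)$; - (c) $d_n=O(n)$, and $\alpha_n=\Theta\big(1/(n\log n)\big)$; - (d) $d_n=O(n^q)$ for some $q\ge1$, and $\alpha_n=\Theta\big(1/(n\log n\,\log\log n)\big)$. 4. *(Reciprocity.)* Let $$E(y)=\inf_{x^*\in\mathcal X^*}\Big(\|x^*\|_2^2-\|\Pi(y)\|_2^2+2\langle y,\Pi(y)-x^*\rangle\Big),\qquad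 y\in\mathbb R^d .$$ For every sequence $(y_n)$ in $\mathbb R^d$, if $\Pi(y_n)$ converges to $\mathcal X^*$, then $E(y_n)\to0$. **Theorem.** Let $\omega_1,\omega_2,\dots$ be i.i.d. with law $P$, let $Y_0\in\mathbb R^d$ be deterministic, and let $(X_n,Y_n)_{n\ge0}$ be the iterates of distributed asynchronous stochastic gradient descent with lazy projection: $$X_n=\Pi(Y_n),\qquad Y_{n+1}=Y_n-\alpha_{n+1}\nabla F(X_{s(n)};\omega_{n+1}),\qquad n\ge0 .$$ Then, almost surely, $X_n$ converges to the solution set $\mathcal X^*$, that is, $\operatorname{dist}(X_n,\mathcal X^*)\to0$. -/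

import Mathlib

open Set Filter Topology MeasureTheory ProbabilityTheory
open scoped NNReal ENNReal RealInnerProductSpace

namespace DASGD

noncomputable section

/-- `E d` is `ℝ^d` with the Euclidean norm. -/
abbrev E (d : ℕ) : Type := EuclideanSpace ℝ (Fin d)

/-- `p` is a nearest point of `K` to `y`. -/
def IsNearestPoint {d : ℕ} (K : Set (E d)) (y p : E d) : Prop :=
  p ∈ K ∧ ∀ z ∈ K, ‖y - p‖ ≤ ‖y - z‖

/-- The Euclidean projection onto `K`. For a nonempty compact convex `K` the nearest point exists
and is unique, see `isNearestPoint_proj` and `proj_eq_of_isNearestPoint`. -/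
def proj {d : ℕ} (K : Set (E d)) (y : E d) : E d :=
  Classical.epsilon (IsNearestPoint K y)

theorem isNearestPoint_proj {d : ℕ} {K : Set (E d)} (hne : K.Nonempty) (hK : IsCompact K)
    (y : E d) : IsNearestPoint K y (proj K y) := by
  refine Classical.epsilon_spec (p := IsNearestPoint K y) ?_
  obtain ⟨p, hp, hmin⟩ := hK.exists_isMinOn hne
    (f := fun z => ‖y - z‖) (by fun_prop)
  exact ⟨p, hp, fun z hz => hmin hz⟩

theorem IsNearestPoint.unique {d : ℕ} {K : Set (E d)} (hc : Convex ℝ K) {y p q : E d}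
    (hp : IsNearestPoint K y p) (hq : IsNearestPoint K y q) : p = q := by
  have key : ∀ {a : E d}, IsNearestPoint K y a → ∀ w ∈ K, ⟪y - a, w - a⟫ ≤ 0 := by
    intro a ha
    refine (norm_eq_iInf_iff_real_inner_le_zero hc ha.1).1 ?_
    have : Nonempty K := ⟨⟨a, ha.1⟩⟩
    refine le_antisymm (le_ciInf fun w => ha.2 w w.2) ?_
    exact ciInf_le ⟨0, by rintro _ ⟨w, rfl⟩; exact norm_nonneg _⟩ (⟨a, ha.1⟩ : K)
  have h1 := key hp q hq.1
  have h2 := key hq p hp.1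
  have h3 : ⟪q - p, q - p⟫ ≤ 0 := by
    have : ⟪q - p, q - p⟫ = ⟪y - p, q - p⟫ + ⟪y - q, p - q⟫ := by
      have e : p - q = -(q - p) := by abel
      rw [e, inner_neg_right, ← sub_eq_add_neg, ← inner_sub_left]
      congr 1
      abel
    linarith
  have h4 : q - p = 0 := by
    rw [real_inner_self_eq_norm_sq] at h3
    exact norm_eq_zero.1 (pow_eq_zero_iff two_ne_zero |>.1 (le_antisymm h3 (sq_nonneg _)))
  exact (sub_eq_zero.1 h4).symm

theorem proj_eq_of_isNearestPoint {d : ℕ} {K : Set (E d)} (hK : IsCompact K) (hc : Convex ℝ K)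
    {y p : E d} (hp : IsNearestPoint K y p) : proj K y = p :=
  (isNearestPoint_proj ⟨p, hp.1⟩ hK y).unique hc hp

/-- The objective `f(x) = 𝔼[F(x; ω)]`, where `P` is the law of `ω`. -/
def objective {d : ℕ} {Ξ : Type*} [MeasurableSpace Ξ] (P : Measure Ξ) (F : E d → Ξ → ℝ)
    (x : E d) : ℝ :=
  ∫ ω, F x ω ∂P

/-- The solution set `X*` of the problem: minimize `f(x) = 𝔼[F(x; ω)]` over `x ∈ X`. -/
def solutionSet {d : ℕ} {Ξ : Type*} [MeasurableSpace Ξ] (P : Measure Ξ) (F : E d → Ξ → ℝ)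
    (X : Set (E d)) : Set (E d) :=
  {x | x ∈ X ∧ ∀ z ∈ X, objective P F x ≤ objective P F z}

/-- The regularity assumption on the stochastic objective. Only the values `F x ω` with `x ∈ X`
matter, and `gradF x ω` is the gradient `∇F(x; ω)` relative to `X`. It is unique when `X` has
nonempty interior; an ordinary gradient of an extension of `F(·; ω)` to a neighbourhood of `X`
qualifies in general. -/
structure SmoothWithMoments {d : ℕ} {Ξ : Type*} [MeasurableSpace Ξ] (P : Measure Ξ)
    (X : Set (E d)) (F : E d → Ξ → ℝ) (gradF : E d → Ξ → E d) : Prop where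
  /-- The objective `f = 𝔼[F(·; ω)]` is well defined on `X`. -/
  integrable : ∀ x ∈ X, Integrable (F x) P
  /-- The stochastic gradient is (jointly) measurable on `X × Ξ`. -/
  measurable_grad : Measurable fun p : X × Ξ => gradF p.1 p.2
  /-- For almost every `ω`, the function `F(·; ω)` is differentiable, with gradient `gradF · ω`. -/
  differentiable : ∀ᵐ ω ∂P, ∀ x ∈ X, HasGradientWithinAt (fun z => F z ω) (gradF x ω) X x
  /-- Finite second moments: `sup_{x ∈ X} 𝔼 ‖∇F(x; ω)‖² < ∞`. -/
  second_moment : (⨆ x ∈ X, ∫⁻ ω, ‖gradF x ω‖ₑ ^ 2 ∂P) < ⊤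
  /-- The mean gradient `x ↦ 𝔼[∇F(x; ω)]` is Lipschitz on `X`. -/
  lipschitz : ∃ L : ℝ≥0, LipschitzOnWith L (fun x => ∫ ω, gradF x ω ∂P) X

/-- Variational coherence in the mean. -/
def VariationallyCoherent {d : ℕ} {Ξ : Type*} [MeasurableSpace Ξ] (P : Measure Ξ)
    (X : Set (E d)) (F : E d → Ξ → ℝ) (gradF : E d → Ξ → E d) : Prop :=
  ∀ xs ∈ solutionSet P F X, ∀ x ∈ X,
    0 ≤ ∫ ω, ⟪gradF x ω, x - xs⟫ ∂P ∧
      (∫ ω, ⟪gradF x ω, x - xs⟫ ∂P = 0 → x ∈ solutionSet P F X)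

/-- `dl m` bounds the delay of every gradient that was requested at iteration `m`, where `s n` is
the iteration at which the gradient received at iteration `n` was requested:
`s n ≤ n` and `n - s n ≤ dl (s n)`. -/
structure IsDelaySchedule (s dl : ℕ → ℕ) : Prop where
  le_self : ∀ n, s n ≤ n
  delay_le : ∀ n, n - s n ≤ dl (s n)

/-- The four regimes of delays and step sizes. -/
def DelayStepRegime (dl : ℕ → ℕ) (α : ℕ → ℝ) : Prop :=
  (∃ D : ℕ, (∀ n, dl n ≤ D) ∧ Summable (fun n => α (n + 1) ^ 2) ∧
      Tendsto (fun N => ∑ n ∈ Finset.range N, α (n + 1)) atTop atTop) ∨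
  (∃ p : ℝ, 0 < p ∧ p < 1 ∧ (fun n => (dl n : ℝ)) =O[atTop] (fun n => (n : ℝ) ^ p) ∧
      α =Θ[atTop] fun n => 1 / (n : ℝ)) ∨
  ((fun n => (dl n : ℝ)) =O[atTop] (fun n => (n : ℝ)) ∧
      α =Θ[atTop] fun n => 1 / ((n : ℝ) * Real.log n)) ∨
  (∃ q : ℝ, 1 ≤ q ∧ (fun n => (dl n : ℝ)) =O[atTop] (fun n => (n : ℝ) ^ q) ∧
      α =Θ[atTop] fun n => 1 / ((n : ℝ) * Real.log n * Real.log (Real.log n)))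

/-- A sequence converges to a set if its distance to the set tends to `0`. (The extended distance
to the empty set is `∞`.) -/
def ConvergesToSet {d : ℕ} (x : ℕ → E d) (S : Set (E d)) : Prop :=
  Tendsto (fun n => Metric.infEDist (x n) S) atTop (𝓝 0)

/-- The energy `‖x*‖² - ‖Π(y)‖² + 2⟨y, Π(y) - x*⟩` relative to a fixed solution `x*`. -/
def energyAt {d : ℕ} (X : Set (E d)) (xs y : E d) : ℝ :=
  ‖xs‖ ^ 2 - ‖proj X y‖ ^ 2 + 2 * ⟪y, proj X y - xs⟫

/-- The energy of `y`: the infimum of `energyAt X xs y` over `xs ∈ S`. -/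
def energy {d : ℕ} (X S : Set (E d)) (y : E d) : ℝ :=
  ⨅ xs : S, energyAt X xs y

/-- Reciprocity: the energy vanishes along every sequence whose projections converge to `S`. -/
def Reciprocity {d : ℕ} (X S : Set (E d)) : Prop :=
  ∀ y : ℕ → E d, ConvergesToSet (fun n => proj X (y n)) S →
    Tendsto (fun n => energy X S (y n)) atTop (𝓝 0)

/-- `ω 1, ω 2, …` are independent and identically distributed with law `P`. -/
structure IsIIDSample {Ω Ξ : Type*} [MeasurableSpace Ω] [MeasurableSpace Ξ] (μ : Measure Ω)
    (P : Measure Ξ) (ω : ℕ → Ω → Ξ) : Prop where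
  measurable : ∀ n, Measurable (ω (n + 1))
  law : ∀ n, μ.map (ω (n + 1)) = P
  indep : iIndepFun (fun n => ω (n + 1)) μ

/-- `(Xs, Ys)` are the iterates of distributed asynchronous stochastic gradient descent with lazy
projection, started at `y₀`:
`X_n = Π(Y_n)` and `Y_{n+1} = Y_n - α_{n+1} ∇F(X_{s(n)}; ω_{n+1})`. -/
structure IsDASGD {d : ℕ} {Ω Ξ : Type*} (X : Set (E d)) (gradF : E d → Ξ → E d)
    (s : ℕ → ℕ) (α : ℕ → ℝ) (y₀ : E d) (ω : ℕ → Ω → Ξ) (Xs Ys : ℕ → Ω → E d) : Prop where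
  init : ∀ w, Ys 0 w = y₀
  project : ∀ n w, Xs n w = proj X (Ys n w)
  step : ∀ n w, Ys (n + 1) w = Ys n w - α (n + 1) • gradF (Xs (s n) w) (ω (n + 1) w)

end

end DASGD

/-! The noise is removed pathwise, leaving a deterministic descent. Put `g x = ∫ gradF x`. The
gradient received at step `n` is `g` at the delayed point plus noise, and the delayed point depends
only on the first `n` samples, so the weighted noise is a sum of martingale differences with
summable variances. It converges almost surely to some `M` (`ae_exists_tendsto_noise`).

Fix such a path and let `m n` be the partial noise sums. The shifted iterate `z n = y n + (m n - M)`
moves only by `-α (n + 1) • g (proj X (y (s n)))`, and `z n - y n → 0`. Over a delay window `y + m`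
moves at most a constant times the sum of the step sizes there, which tends to zero in all four
regimes (`DelayStepRegime.goodSteps`). As the projection is nonexpansive and `g` is Lipschitz, `z`
follows `g` at its own projection up to a vanishing error.

The energy is a Lyapunov function for `z`: it dominates the squared distance to the solutions and
decreases to first order by coherence. Reciprocity and compactness make the decrease uniform while
the energy is not small, so divergence of the step sizes forces it to zero
(`tendsto_infDist_of_coherent`). -/

namespace DASGD

/-! ### Projection and energy inequalities. -/

section Energy

variable {d : ℕ} {X : Set (E d)}

theorem inner_sub_proj_nonpos (hne : X.Nonempty) (hK : IsCompact X) (hc : Convex ℝ X) (y : E d)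
    {w : E d} (hw : w ∈ X) : ⟪y - proj X y, w - proj X y⟫ ≤ 0 := by
  have h := isNearestPoint_proj hne hK y
  refine (norm_eq_iInf_iff_real_inner_le_zero hc h.1).1 ?_ w hw
  have : Nonempty X := ⟨⟨_, h.1⟩⟩
  refine le_antisymm (le_ciInf fun w => h.2 w w.2) ?_
  exact ciInf_le ⟨0, by rintro _ ⟨w, rfl⟩; exact norm_nonneg _⟩ (⟨_, h.1⟩ : X)

theorem proj_mem (hne : X.Nonempty) (hK : IsCompact X) (y : E d) : proj X y ∈ X :=
  (isNearestPoint_proj hne hK y).1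

theorem norm_proj_sub_proj_le (hne : X.Nonempty) (hK : IsCompact X) (hc : Convex ℝ X)
    (y z : E d) : ‖proj X y - proj X z‖ ≤ ‖y - z‖ := by
  have h1 := inner_sub_proj_nonpos hne hK hc y (proj_mem hne hK z)
  have h2 := inner_sub_proj_nonpos hne hK hc z (proj_mem hne hK y)
  have h3 : ‖proj X y - proj X z‖ ^ 2 ≤ ⟪y - z, proj X y - proj X z⟫ := by
    rw [← real_inner_self_eq_norm_sq]
    simp only [inner_sub_left, inner_sub_right] at *
    linarith [real_inner_comm (proj X y) (proj X z)]
  have h4 := real_inner_le_norm (y - z) (proj X y - proj X z)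
  by_contra! h
  have := norm_nonneg (y - z)
  nlinarith

theorem continuous_proj (hne : X.Nonempty) (hK : IsCompact X) (hc : Convex ℝ X) :
    Continuous (proj X) :=
  (LipschitzWith.of_dist_le_mul (K := 1) fun y z => by
    simpa [dist_eq_norm] using norm_proj_sub_proj_le hne hK hc y z).continuous

/-- With `p = proj X y`, the two sides differ by `2 * ⟪y - p, p - xs⟫`, which is nonnegative by the
obtuse angle property of the projection. -/
theorem norm_proj_sub_sq_le_energyAt (hne : X.Nonempty) (hK : IsCompact X) (hc : Convex ℝ X)
    {xs : E d} (hxs : xs ∈ X) (y : E d) : ‖proj X y - xs‖ ^ 2 ≤ energyAt X xs y := by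
  have h := inner_sub_proj_nonpos hne hK hc y hxs
  rw [energyAt]
  simp only [← real_inner_self_eq_norm_sq, inner_sub_left, inner_sub_right] at *
  linarith [real_inner_comm (proj X y) xs]

/-- As a function of `y`, the energy is `‖y‖² - dist(y, X)²` plus an affine term; its gradient is `2
(proj X y - xs)`, and this is its descent inequality. -/
theorem energyAt_sub_le (hne : X.Nonempty) (hK : IsCompact X) (hc : Convex ℝ X)
    (xs y v : E d) :
    energyAt X xs (y - v) ≤ energyAt X xs y - 2 * ⟪v, proj X y - xs⟫ + ‖v‖ ^ 2 := by
  have h := inner_sub_proj_nonpos hne hK hc y (proj_mem hne hK (y - v))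
  -- With `p = proj X y` and `q = proj X (y - v)`, the slack in the claim is exactly this square
  -- plus `2 * ⟪y - p, p - q⟫`.
  have h2 : 0 ≤ ‖(y - v - proj X (y - v)) - (y - proj X y)‖ ^ 2 := sq_nonneg _
  simp only [energyAt]
  generalize proj X (y - v) = q at *
  generalize proj X y = p at *
  simp only [← real_inner_self_eq_norm_sq, inner_sub_left, inner_sub_right] at *
  linarith [real_inner_comm p q, real_inner_comm v q, real_inner_comm v p, real_inner_comm y q,
    real_inner_comm y p, real_inner_comm y v]

variable {S : Set (E d)}

theorem energy_le_energyAt (hne : X.Nonempty) (hK : IsCompact X) (hc : Convex ℝ X)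
    (hSX : S ⊆ X) {xs : E d} (hxs : xs ∈ S) (y : E d) : energy X S y ≤ energyAt X xs y :=
  ciInf_le (f := fun x : S => energyAt X x y) ⟨0, by
    rintro _ ⟨x, rfl⟩
    exact (sq_nonneg _).trans (norm_proj_sub_sq_le_energyAt hne hK hc (hSX x.2) y)⟩ ⟨xs, hxs⟩

theorem infDist_sq_le_energy (hne : X.Nonempty) (hK : IsCompact X) (hc : Convex ℝ X)
    (hSX : S ⊆ X) (hS : S.Nonempty) (y : E d) :
    Metric.infDist (proj X y) S ^ 2 ≤ energy X S y := by
  have : Nonempty S := hS.to_subtype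
  refine le_ciInf fun xs => le_trans ?_ (norm_proj_sub_sq_le_energyAt hne hK hc (hSX xs.2) y)
  have := Metric.infDist_le_dist_of_mem (x := proj X y) xs.2
  rw [dist_eq_norm] at this
  exact pow_le_pow_left₀ Metric.infDist_nonneg this 2

/-- A uniform decrease of the energies relative to all points of `S` passes to their infimum. -/
theorem energy_sub_le (hne : X.Nonempty) (hK : IsCompact X) (hc : Convex ℝ X)
    (hSX : S ⊆ X) (hS : S.Nonempty) {y v : E d} {r : ℝ}
    (h : ∀ xs ∈ S, r ≤ 2 * ⟪v, proj X y - xs⟫ - ‖v‖ ^ 2) :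
    energy X S (y - v) ≤ energy X S y - r := by
  have : Nonempty S := hS.to_subtype
  rw [le_sub_iff_add_le]
  refine le_ciInf fun xs => ?_
  have h1 := energy_le_energyAt hne hK hc hSX xs.2 (y - v)
  have h2 := energyAt_sub_le hne hK hc xs y v
  linarith [h xs xs.2]

theorem convergesToSet_iff (hS : S.Nonempty) (x : ℕ → E d) :
    ConvergesToSet x S ↔ Tendsto (fun n => Metric.infDist (x n) S) atTop (𝓝 0) := by
  rw [ConvergesToSet, ← ENNReal.tendsto_toReal_iff (fun n => Metric.infEDist_ne_top hS)
    ENNReal.zero_ne_top]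
  rfl

/-- Reciprocity in the form used below: a large energy keeps the projection away from `S`. -/
theorem Reciprocity.exists_le_infDist (hrec : Reciprocity X S) (hS : S.Nonempty) {δ : ℝ}
    (hδ : 0 < δ) :
    ∃ ε > 0, ∀ y, δ ≤ energy X S y → ε ≤ Metric.infDist (proj X y) S := by
  by_contra! h
  choose y hy1 hy2 using fun n : ℕ => h (1 / ((n : ℝ) + 1)) Nat.one_div_pos_of_nat
  have hlim : Tendsto (fun n => energy X S (y n)) atTop (𝓝 0) := by
    refine hrec y ((convergesToSet_iff hS _).2 ?_)
    exact squeeze_zero (fun _ => Metric.infDist_nonneg) (fun n => (hy2 n).le)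
      tendsto_one_div_add_atTop_nhds_zero_nat
  exact absurd (ge_of_tendsto' hlim hy1) (not_le.2 hδ)

end Energy

/-! ### A scalar descent principle. -/

section Scalar

/-- A sequence whose upward jumps vanish and which decreases at a rate proportional to a divergent
series whenever it is not small tends to zero. -/
theorem tendsto_zero_of_decrease {a γ : ℕ → ℝ} (ha : ∀ n, 0 ≤ a n)
    (hγ : Tendsto (fun N => ∑ n ∈ Finset.range N, γ n) atTop atTop) (hγ0 : ∀ n, 0 ≤ γ n)
    (hdec : ∀ δ > 0, ∃ c > 0, ∀ᶠ n in atTop, δ ≤ a n → a (n + 1) ≤ a n - c * γ n)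
    (hjump : ∀ δ > 0, ∀ᶠ n in atTop, a (n + 1) ≤ a n + δ) :
    Tendsto a atTop (𝓝 0) := by
  refine tendsto_order.2 ⟨fun b hb => .of_forall fun n => hb.trans_le (ha n), fun b hb => ?_⟩
  obtain ⟨c, hc, h1⟩ := hdec (b / 3) (by positivity)
  obtain ⟨N, hN⟩ := eventually_atTop.1 (h1.and (hjump (b / 3) (by positivity)))
  -- Otherwise the decrease applies forever and the divergent series drives `a` below zero.
  obtain ⟨k, hk, hak⟩ : ∃ k ≥ N, a k < b / 3 := by
    by_contra! hcon
    have hle : ∀ m, a (N + m) ≤ a N - c * ∑ n ∈ Finset.range m, γ (N + n) := by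
      intro m
      induction m with
      | zero => simp
      | succ m ih =>
        have := (hN (N + m) (by omega)).1 (hcon _ (by omega))
        rw [Finset.sum_range_succ, ← add_assoc]
        linarith
    obtain ⟨m, hm1, hm⟩ := ((hγ.eventually_gt_atTop
      (∑ n ∈ Finset.range N, γ n + a N / c)).and (eventually_ge_atTop N)).exists
    obtain ⟨j, rfl⟩ := Nat.exists_eq_add_of_le hm
    rw [Finset.sum_range_add] at hm1
    have h2 : a N / c < ∑ n ∈ Finset.range j, γ (N + n) := by linarith
    rw [div_lt_iff₀ hc] at h2
    linarith [hle j, ha (N + j)]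
  -- Below `b / 3` one jump adds at most `b / 3`; from `b / 3` upwards the sequence does not
  -- increase.
  have hstay : ∀ m ≥ k, a m < 2 * b / 3 := by
    intro m hm
    induction m, hm using Nat.le_induction with
    | base => linarith
    | succ m hm ih =>
      have := hN m (hk.trans hm)
      by_cases h : b / 3 ≤ a m
      · have := this.1 h
        have := mul_nonneg hc.le (hγ0 m)
        linarith
      · linarith [this.2]
  filter_upwards [eventually_ge_atTop k] with m hm
  linarith [hstay m hm]

end Scalar

/-! ### Divergence of the step sizes and smallness over delay windows. -/

section StepSizes

theorem log_add_one_sub_log_le {x : ℝ} (hx : 0 < x) : Real.log (x + 1) - Real.log x ≤ 1 / x := by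
  rw [← Real.log_div (by positivity) hx.ne']
  refine (Real.log_le_sub_one_of_pos (by positivity)).trans_eq ?_
  field_simp
  ring

theorem log_sub_log_le_div {x y : ℝ} (hx : 0 < x) (hy : 0 < y) :
    Real.log y - Real.log x ≤ (y - x) / x := by
  rw [← Real.log_div hy.ne' hx.ne']
  refine (Real.log_le_sub_one_of_pos (by positivity)).trans_eq ?_
  field_simp

theorem le_log_sub_log {x y : ℝ} (hx : 0 < x) (hy : 0 < y) :
    (y - x) / y ≤ Real.log y - Real.log x := by
  have := log_sub_log_le_div hy hx
  have h : (x - y) / y = - ((y - x) / y) := by ring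
  linarith

/-- `L` plays the part of an antiderivative of `b`: its increments telescope to infinity and are
eventually bounded by multiples of `α`. It is used with one, two and three nested logarithms. -/
theorem tendsto_sum_of_isBigO {α b L : ℕ → ℝ} (hα : ∀ n, 0 < α (n + 1)) (hb : b =O[atTop] α)
    (hL : Tendsto L atTop atTop) (hLb : ∀ᶠ n in atTop, L (n + 1) - L n ≤ ‖b n‖) :
    Tendsto (fun N => ∑ n ∈ Finset.range N, α (n + 1)) atTop atTop := by
  obtain ⟨C, hC, hbC⟩ := hb.exists_pos
  obtain ⟨m, hm⟩ := eventually_atTop.1 (hLb.and (hbC.bound.and (eventually_ge_atTop 1)))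
  -- The sum over `range N` ends at `α N`, so the terms before `α m` are those over `range (m - 1)`.
  have key : ∀ N ≥ m, L (N + 1) - L m + C * ∑ n ∈ Finset.range (m - 1), α (n + 1) ≤
      C * ∑ n ∈ Finset.range N, α (n + 1) := by
    have hstep : ∀ N ≥ m, L (N + 1) - L N ≤ C * α N := by
      intro N hN
      obtain ⟨h1, h2, h3⟩ := hm N hN
      obtain ⟨j, rfl⟩ := Nat.exists_eq_add_of_le' h3
      rw [Real.norm_of_nonneg (hα j).le] at h2
      exact h1.trans h2
    intro N hN
    induction N, hN using Nat.le_induction with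
    | base =>
      have h3 := (hm m le_rfl).2.2
      obtain ⟨j, rfl⟩ := Nat.exists_eq_add_of_le' h3
      have := hstep _ le_rfl
      rw [Finset.sum_range_succ, Nat.add_sub_cancel]
      linarith
    | succ N hN ih =>
      have := hstep (N + 1) (by omega)
      rw [Finset.sum_range_succ]
      linarith
  have h2 : Tendsto (fun N => C * ∑ n ∈ Finset.range N, α (n + 1)) atTop atTop := by
    refine tendsto_atTop_mono' _ (eventually_atTop.2 ⟨m, key⟩) ?_
    refine tendsto_atTop_add_const_right _ _ (tendsto_atTop_add_const_right _ _ ?_)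
    exact hL.comp (tendsto_add_atTop_nat 1)
  refine (h2.const_mul_atTop (inv_pos.2 hC)).congr fun N => ?_
  field_simp

theorem tendsto_log_natCast : Tendsto (fun n : ℕ => Real.log n) atTop atTop :=
  Real.tendsto_log_atTop.comp tendsto_natCast_atTop_atTop

theorem tendsto_log_log_natCast : Tendsto (fun n : ℕ => Real.log (Real.log n)) atTop atTop :=
  Real.tendsto_log_atTop.comp tendsto_log_natCast

theorem summable_sq_of_isBigO {α : ℕ → ℝ} (h : α =O[atTop] fun n : ℕ => 1 / (n : ℝ)) :
    Summable fun n => α (n + 1) ^ 2 := by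
  have h1 : Summable fun n => α n ^ 2 := by
    refine summable_of_isBigO_nat (g := fun n : ℕ => 1 / (n : ℝ) ^ 2)
      (Real.summable_one_div_nat_pow.2 one_lt_two) ?_
    simpa [div_pow] using h.pow 2
  exact (summable_nat_add_iff 1).2 h1

theorem log_log_add_one_sub_le {n : ℕ} (hn : 3 ≤ n) :
    Real.log (Real.log ((n : ℝ) + 1)) - Real.log (Real.log n) ≤ 1 / (n * Real.log n) := by
  have hn' : (3 : ℝ) ≤ n := by exact_mod_cast hn
  have h1 : 0 < Real.log n := Real.log_pos (by linarith)
  have h2 : 0 < Real.log ((n : ℝ) + 1) := Real.log_pos (by linarith)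
  refine (log_sub_log_le_div h1 h2).trans ?_
  rw [← div_div]
  exact div_le_div_of_nonneg_right (log_add_one_sub_log_le (by linarith)) h1.le

theorem log_log_log_add_one_sub_le {n : ℕ} (hn : 3 ≤ n) :
    Real.log (Real.log (Real.log ((n : ℝ) + 1))) - Real.log (Real.log (Real.log n)) ≤
      1 / (n * Real.log n * Real.log (Real.log n)) := by
  have hn' : (3 : ℝ) ≤ n := by exact_mod_cast hn
  have h0 : 1 < Real.log n := by
    rw [Real.lt_log_iff_exp_lt (by linarith)]
    linarith [Real.exp_one_lt_d9]
  have h0' : 1 < Real.log ((n : ℝ) + 1) :=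
    h0.trans_le (Real.log_le_log (by linarith) (by linarith))
  have h1 := Real.log_pos h0
  refine (log_sub_log_le_div h1 (Real.log_pos h0')).trans ?_
  rw [← div_div]
  exact div_le_div_of_nonneg_right (log_log_add_one_sub_le hn) h1.le

theorem one_div_le_log_log_sub {n : ℕ} (hn : 3 ≤ n) :
    1 / (((n + 1 : ℕ) : ℝ) * Real.log ((n + 1 : ℕ) : ℝ)) ≤
      Real.log (Real.log ((n + 1 : ℕ) : ℝ)) - Real.log (Real.log n) := by
  have hn' : (3 : ℝ) ≤ n := by exact_mod_cast hn
  push_cast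
  have h1 : 0 < Real.log n := Real.log_pos (by linarith)
  have h2 : 0 < Real.log ((n : ℝ) + 1) := Real.log_pos (by linarith)
  refine le_trans ?_ (le_log_sub_log h1 h2)
  rw [← div_div]
  refine div_le_div_of_nonneg_right ?_ h2.le
  refine le_trans ?_ (le_log_sub_log (by linarith) (by linarith))
  simp

/-- A request made at iteration `j` is received no later than `j + dl j`. The sum below is a crude
common bound for all `j < m`. -/
theorem IsDelaySchedule.tendsto {s dl : ℕ → ℕ} (hs : IsDelaySchedule s dl) :
    Tendsto s atTop atTop := by
  refine tendsto_atTop.2 fun m => ?_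
  filter_upwards [eventually_gt_atTop (∑ j ∈ Finset.range m, (j + dl j))] with n hn
  by_contra! h
  have h1 := Finset.single_le_sum (f := fun j => j + dl j) (fun _ _ => Nat.zero_le _)
    (Finset.mem_range.2 h)
  have h2 := hs.delay_le n
  omega

/-- The total step size during a delay vanishes if the product of the delay with any later step
size does. -/
theorem tendsto_sum_Ioc_of_mul {s dl : ℕ → ℕ} (hs : IsDelaySchedule s dl) {α : ℕ → ℝ}
    (hα : ∀ n, 0 < α (n + 1))
    (h : ∀ ε > 0, ∀ᶠ m in atTop, ∀ k > m, (dl m : ℝ) * α k ≤ ε) :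
    Tendsto (fun n => ∑ k ∈ Finset.Ioc (s n) n, α k) atTop (𝓝 0) := by
  have h0 : ∀ n, 0 ≤ ∑ k ∈ Finset.Ioc (s n) n, α k := fun n =>
    Finset.sum_nonneg fun k hk => by
      obtain ⟨j, rfl⟩ := Nat.exists_eq_add_of_le' (Nat.one_le_of_lt (Finset.mem_Ioc.1 hk).1)
      exact (hα j).le
  refine tendsto_order.2 ⟨fun b hb => .of_forall fun n => hb.trans_le (h0 n), fun b hb => ?_⟩
  filter_upwards [hs.tendsto.eventually (h (b / 2) (by positivity))] with n hn
  have hdl := hs.delay_le n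
  rcases Nat.eq_zero_or_pos (dl (s n)) with h1 | h1
  · rw [Finset.Ioc_eq_empty (by omega), Finset.sum_empty]
    exact hb
  · have h1' : (0 : ℝ) < dl (s n) := by exact_mod_cast h1
    have h2 : ∑ k ∈ Finset.Ioc (s n) n, α k ≤ ((n - s n : ℕ) : ℝ) * (b / 2 / dl (s n)) := by
      refine (Finset.sum_le_card_nsmul _ _ (b / 2 / dl (s n)) fun k hk => ?_).trans_eq (by simp)
      rw [le_div_iff₀' h1']
      exact hn k (Finset.mem_Ioc.1 hk).1
    have h3 : ((n - s n : ℕ) : ℝ) * (b / 2 / dl (s n)) ≤ dl (s n) * (b / 2 / dl (s n)) :=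
      mul_le_mul_of_nonneg_right (by exact_mod_cast hdl) (by positivity)
    rw [mul_div_cancel₀ _ h1'.ne'] at h3
    linarith

/-- The counting argument for regimes (b) and (c): every later step size is at most a constant times
`b m`. -/
theorem tendsto_sum_Ioc_of_antitone {s dl : ℕ → ℕ} (hs : IsDelaySchedule s dl) {α b : ℕ → ℝ}
    (hα : ∀ n, 0 < α (n + 1)) (hb0 : ∀ n, 0 ≤ b n) (hαb : α =O[atTop] b) {m₀ : ℕ}
    (hb : ∀ m ≥ m₀, ∀ k > m, b k ≤ b m)
    (hlim : Tendsto (fun n => (dl n : ℝ) * b n) atTop (𝓝 0)) :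
    Tendsto (fun n => ∑ k ∈ Finset.Ioc (s n) n, α k) atTop (𝓝 0) := by
  refine tendsto_sum_Ioc_of_mul hs hα fun ε hε => ?_
  obtain ⟨C, hC, hCb⟩ := hαb.exists_pos
  have h1 : Tendsto (fun n => C * ((dl n : ℝ) * b n)) atTop (𝓝 0) := by
    simpa using hlim.const_mul C
  filter_upwards [h1.eventually (ge_mem_nhds hε), eventually_forall_ge_atTop.2 hCb.bound,
    eventually_ge_atTop m₀] with m hm1 hm2 hm3 k hk
  have h2 := hm2 k hk.le
  rw [Real.norm_of_nonneg (hb0 k)] at h2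
  have h3 : α k ≤ C * b m := ((le_abs_self _).trans h2).trans
    (mul_le_mul_of_nonneg_left (hb m hm3 k hk) hC.le)
  calc (dl m : ℝ) * α k ≤ dl m * (C * b m) := mul_le_mul_of_nonneg_left h3 (by positivity)
    _ = C * (dl m * b m) := by ring
    _ ≤ ε := hm1

/-- Polynomially bounded delays with step sizes `O(1 / (n log n log log n))`. -/
theorem tendsto_sum_Ioc_of_log_log {s dl : ℕ → ℕ} (hs : IsDelaySchedule s dl) {α : ℕ → ℝ}
    (hα : ∀ n, 0 < α (n + 1)) {q : ℝ} (hq : 1 ≤ q)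
    (hdl : (fun n => (dl n : ℝ)) =O[atTop] fun n : ℕ => (n : ℝ) ^ q)
    (hαO : α =O[atTop] fun n : ℕ => 1 / ((n : ℝ) * Real.log n * Real.log (Real.log n))) :
    Tendsto (fun n => ∑ k ∈ Finset.Ioc (s n) n, α k) atTop (𝓝 0) := by
  obtain ⟨C, hC, hCb⟩ := hdl.exists_pos
  obtain ⟨K, hK, hKb⟩ := hαO.exists_pos
  -- Counting steps is too crude for polynomial delays. A window from `m` to about `m ^ (q + 1)` has
  -- length `log (q + 1)` on the `log log` scale, and the extra factor `1 / log log m` makes its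
  -- total step size vanish.
  have hlim : Tendsto (fun m : ℕ => K / Real.log (Real.log m) * Real.log (q + 1)) atTop (𝓝 0) := by
    simpa using (tendsto_log_log_natCast.const_div_atTop K).mul_const (Real.log (q + 1))
  refine squeeze_zero' (.of_forall fun n => Finset.sum_nonneg fun k hk => ?_) ?_
    (hlim.comp hs.tendsto)
  · obtain ⟨j, rfl⟩ := Nat.exists_eq_add_of_le' (Nat.one_le_of_lt (Finset.mem_Ioc.1 hk).1)
    exact (hα j).le
  filter_upwards [hs.tendsto.eventually (hCb.bound.and ((eventually_forall_ge_atTop.2 hKb.bound).and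
    ((eventually_ge_atTop 3).and ((tendsto_natCast_atTop_atTop (R := ℝ)).eventually_ge_atTop
      (1 + C)))))] with n ⟨hn1, hn2, hn3, hn4⟩
  simp only [Function.comp_apply]
  have hsn := hs.le_self n
  have hdn := hs.delay_le n
  generalize s n = m at *
  have hm3 : (3 : ℝ) ≤ m := by exact_mod_cast hn3
  have hlog : ∀ k : ℕ, m ≤ k → 1 < Real.log k := fun k hk => by
    have : (m : ℝ) ≤ k := by exact_mod_cast hk
    rw [Real.lt_log_iff_exp_lt (by linarith)]
    linarith [Real.exp_one_lt_d9]
  have hm1 := hlog m le_rfl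
  have hstep : ∀ k, m ≤ k → α (k + 1) ≤ K / Real.log (Real.log m) *
      (Real.log (Real.log ((k + 1 : ℕ) : ℝ)) - Real.log (Real.log k)) := by
    intro k hk
    have h1 := (le_abs_self _).trans (hn2 (k + 1) (by omega))
    have hk1 := hlog (k + 1) (by omega)
    have hll : Real.log (Real.log m) ≤ Real.log (Real.log ((k + 1 : ℕ) : ℝ)) := by
      refine Real.log_le_log (by linarith) (Real.log_le_log (by linarith) ?_)
      exact_mod_cast hk.trans (Nat.le_succ k)
    have hll0 : 0 < Real.log (Real.log m) := Real.log_pos hm1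
    have hpos : (0 : ℝ) < ((k + 1 : ℕ) : ℝ) := by positivity
    have hx : 0 < 1 / (((k + 1 : ℕ) : ℝ) * Real.log ((k + 1 : ℕ) : ℝ)) := by positivity
    rw [← div_div, Real.norm_of_nonneg (div_nonneg hx.le (hll0.le.trans hll))] at h1
    refine h1.trans ?_
    rw [div_mul_eq_mul_div, mul_div_assoc]
    refine mul_le_mul_of_nonneg_left ?_ hK.le
    exact div_le_div₀ (hx.le.trans (one_div_le_log_log_sub (by omega)))
      (one_div_le_log_log_sub (by omega)) hll0 hll
  have hsum : ∑ k ∈ Finset.Ioc m n, α k ≤ K / Real.log (Real.log m) *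
      (Real.log (Real.log n) - Real.log (Real.log m)) := by
    clear hdn
    induction n, hsn using Nat.le_induction with
    | base => simp
    | succ k hk ih =>
      rw [Finset.sum_Ioc_succ_top (by omega)]
      have := hstep k hk
      linarith
  refine hsum.trans (mul_le_mul_of_nonneg_left ?_ (div_nonneg hK.le (Real.log_pos hm1).le))
  -- `n ≤ m + C m ^ q ≤ (1 + C) m ^ q`, and `m ≥ 1 + C` absorbs the constant.
  have hn : (n : ℝ) ≤ (m : ℝ) ^ (q + 1) := by
    have h1 : (n : ℝ) ≤ m + dl m := by exact_mod_cast (by omega : n ≤ m + dl m)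
    rw [Real.norm_of_nonneg (by positivity), Real.norm_of_nonneg (by positivity)] at hn1
    have h2 : (m : ℝ) ≤ (m : ℝ) ^ q := by
      simpa using Real.rpow_le_rpow_of_exponent_le (by linarith : (1 : ℝ) ≤ m) hq
    rw [Real.rpow_add_one (by positivity)]
    have : 0 ≤ (m : ℝ) ^ q := by positivity
    nlinarith
  have hn' := hlog n hsn
  have h1 : Real.log n ≤ (q + 1) * Real.log m := by
    rw [← Real.log_rpow (by linarith)]
    refine Real.log_le_log ?_ hn
    have : (m : ℝ) ≤ n := by exact_mod_cast hsn
    linarith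
  have h2 := Real.log_le_log (by linarith) h1
  rw [Real.log_mul (by linarith) (by linarith)] at h2
  linarith

/-- The properties of the step sizes and delays that the convergence proof uses. -/
structure GoodSteps (s : ℕ → ℕ) (α : ℕ → ℝ) : Prop where
  summable_sq : Summable fun n => α (n + 1) ^ 2
  tendsto_sum : Tendsto (fun N => ∑ n ∈ Finset.range N, α (n + 1)) atTop atTop
  tendsto_delay : Tendsto (fun n => ∑ k ∈ Finset.Ioc (s n) n, α k) atTop (𝓝 0)

theorem GoodSteps.tendsto_zero {s : ℕ → ℕ} {α : ℕ → ℝ} (h : GoodSteps s α) :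
    Tendsto (fun n => α (n + 1)) atTop (𝓝 0) := by
  have := h.summable_sq.tendsto_atTop_zero
  rw [tendsto_zero_iff_abs_tendsto_zero]
  simpa [Function.comp_def, Real.sqrt_sq_eq_abs] using this.sqrt

theorem eventually_one_le_log : ∀ᶠ n : ℕ in atTop, 1 ≤ Real.log n :=
  tendsto_log_natCast.eventually_ge_atTop 1

theorem isBigO_one_div_mul {a b : ℕ → ℝ} (ha : ∀ᶠ n in atTop, 0 < a n)
    (hb : ∀ᶠ n in atTop, 1 ≤ b n) :
    (fun n => 1 / (a n * b n)) =O[atTop] fun n => 1 / a n := by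
  refine Asymptotics.IsBigO.of_bound 1 ?_
  filter_upwards [ha, hb] with n h1 h2
  have h3 : 0 < b n := by linarith
  rw [one_mul, Real.norm_of_nonneg (by positivity), Real.norm_of_nonneg (by positivity)]
  exact one_div_le_one_div_of_le h1 (le_mul_of_one_le_right h1.le h2)

theorem DelayStepRegime.goodSteps {s dl : ℕ → ℕ} {α : ℕ → ℝ} (h : DelayStepRegime dl α)
    (hs : IsDelaySchedule s dl) (hα : ∀ n, 0 < α (n + 1)) : GoodSteps s α := by
  have hcast : ∀ᶠ n : ℕ in atTop, (0 : ℝ) < n := by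
    filter_upwards [eventually_gt_atTop 0] with n hn
    exact_mod_cast hn
  have hO1 := isBigO_one_div_mul hcast eventually_one_le_log
  rcases h with ⟨D, hD, h1, h2⟩ | ⟨p, hp0, hp1, hd, hΘ⟩ | ⟨hd, hΘ⟩ | ⟨q, hq, hd, hΘ⟩
  · refine ⟨h1, h2, tendsto_sum_Ioc_of_mul hs hα fun ε hε => ?_⟩
    have h3 : Tendsto (fun n => (D : ℝ) * |α (n + 1)|) atTop (𝓝 0) := by
      simpa [Function.comp_def, Real.sqrt_sq_eq_abs] using
        h1.tendsto_atTop_zero.sqrt.const_mul (D : ℝ)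
    filter_upwards [eventually_forall_ge_atTop.2 (h3.eventually (ge_mem_nhds hε))] with m hm k hk
    obtain ⟨j, rfl⟩ := Nat.exists_eq_add_of_le' (Nat.one_le_of_lt hk)
    refine le_trans ?_ (hm j (by omega))
    rw [abs_of_pos (hα j)]
    exact mul_le_mul_of_nonneg_right (by exact_mod_cast hD m) (hα j).le
  · refine ⟨summable_sq_of_isBigO hΘ.1, tendsto_sum_of_isBigO hα hΘ.2 tendsto_log_natCast ?_,
      tendsto_sum_Ioc_of_antitone hs hα (fun n => by positivity) hΘ.1 (m₀ := 1)
        (fun m hm k hk => ?_) ?_⟩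
    · filter_upwards [hcast] with n hn
      rw [Real.norm_of_nonneg (by positivity)]
      push_cast
      exact log_add_one_sub_log_le hn
    · exact one_div_le_one_div_of_le (by exact_mod_cast hm) (by exact_mod_cast hk.le)
    · have h1 : (fun n : ℕ => (n : ℝ) ^ p * (1 / (n : ℝ))) =ᶠ[atTop]
          fun n : ℕ => (n : ℝ) ^ (-(1 - p)) := by
        filter_upwards [hcast] with n hn
        rw [neg_sub, Real.rpow_sub_one hn.ne', mul_one_div]
      exact ((hd.mul (Asymptotics.isBigO_refl _ _)).trans h1.isBigO).trans_tendsto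
        ((tendsto_rpow_neg_atTop (by linarith)).comp tendsto_natCast_atTop_atTop)
  · refine ⟨summable_sq_of_isBigO (hΘ.1.trans hO1),
      tendsto_sum_of_isBigO hα hΘ.2 tendsto_log_log_natCast ?_,
      tendsto_sum_Ioc_of_antitone hs hα (fun n => ?_) hΘ.1 (m₀ := 3) (fun m hm k hk => ?_) ?_⟩
    · filter_upwards [eventually_ge_atTop 3] with n hn
      push_cast
      exact (log_log_add_one_sub_le hn).trans (le_abs_self _)
    · exact div_nonneg zero_le_one (mul_nonneg (by positivity) (Real.log_natCast_nonneg n))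
    · have hm' : (3 : ℝ) ≤ m := by exact_mod_cast hm
      have hk' : (m : ℝ) ≤ k := by exact_mod_cast hk.le
      have : 0 < Real.log m := Real.log_pos (by linarith)
      have := Real.log_le_log (by linarith) hk'
      refine one_div_le_one_div_of_le (by positivity) ?_
      gcongr
    · have h1 : (fun n : ℕ => (n : ℝ) * (1 / ((n : ℝ) * Real.log n))) =ᶠ[atTop]
          fun n : ℕ => (Real.log n)⁻¹ := by
        filter_upwards [hcast] with n hn
        field_simp
      exact ((hd.mul (Asymptotics.isBigO_refl _ _)).trans h1.isBigO).trans_tendsto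
        tendsto_log_natCast.inv_tendsto_atTop
  · have hO2 := isBigO_one_div_mul (a := fun n : ℕ => (n : ℝ) * Real.log n)
      (by filter_upwards [hcast, eventually_one_le_log] with n h1 h2 using by positivity)
      (tendsto_log_log_natCast.eventually_ge_atTop 1)
    refine ⟨summable_sq_of_isBigO (hΘ.1.trans (hO2.trans hO1)),
      tendsto_sum_of_isBigO hα hΘ.2 (Real.tendsto_log_atTop.comp tendsto_log_log_natCast) ?_,
      tendsto_sum_Ioc_of_log_log hs hα hq hd hΘ.1⟩
    filter_upwards [eventually_ge_atTop 3] with n hn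
    simp only [Function.comp_apply]
    push_cast
    exact (log_log_log_add_one_sub_le hn).trans (le_abs_self _)

end StepSizes

/-! ### Pathwise convergence of delayed descent. -/

section Deterministic

variable {d : ℕ} {X S : Set (E d)} {g : E d → E d}

/-- A positive continuous function on a compact set of pairs `(x, xs)` is bounded away from zero.
Uniformity in `xs` is needed because the energy is an infimum over `S`. -/
theorem exists_pos_le_inner (hK : IsCompact X) (hS : IsCompact S) (hg : ContinuousOn g X)
    (hpos : ∀ xs ∈ S, ∀ x ∈ X, 0 ≤ ⟪g x, x - xs⟫)
    (hcoh : ∀ xs ∈ S, ∀ x ∈ X, ⟪g x, x - xs⟫ = 0 → x ∈ S) {ε : ℝ} (hε : 0 < ε) :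
    ∃ c > 0, ∀ xs ∈ S, ∀ x ∈ X, ε ≤ Metric.infDist x S → c ≤ ⟪g x, x - xs⟫ := by
  have hK' : IsCompact ((X ∩ {x | ε ≤ Metric.infDist x S}) ×ˢ S) :=
    (hK.inter_right (isClosed_le continuous_const (Metric.continuous_infDist_pt S))).prod hS
  have hcont : ContinuousOn (fun p : E d × E d => ⟪g p.1, p.1 - p.2⟫)
      ((X ∩ {x | ε ≤ Metric.infDist x S}) ×ˢ S) :=
    (hg.comp continuousOn_fst fun p hp => hp.1.1).inner
      (continuousOn_fst.sub continuousOn_snd)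
  obtain ⟨c, hc, h⟩ := hK'.exists_forall_le' hcont (a := 0) fun p hp =>
    (hpos p.2 hp.2 p.1 hp.1.1).lt_of_ne fun h => by
      have h1 := hcoh p.2 hp.2 p.1 hp.1.1 h.symm
      have h2 : ε ≤ Metric.infDist p.1 S := hp.1.2
      rw [Metric.infDist_zero_of_mem h1] at h2
      linarith
  exact ⟨c, hc, fun xs hxs x hx hd => h (x, xs) ⟨⟨hx, hd⟩, hxs⟩⟩

/-- Lazily projected descent along asymptotically exact values of a variationally coherent field
converges to the solution set. -/
theorem tendsto_infDist_of_coherent (hne : X.Nonempty) (hK : IsCompact X) (hc : Convex ℝ X)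
    (hSX : S ⊆ X) (hSne : S.Nonempty) (hS : IsClosed S) (hg : ContinuousOn g X)
    (hpos : ∀ xs ∈ S, ∀ x ∈ X, 0 ≤ ⟪g x, x - xs⟫)
    (hcoh : ∀ xs ∈ S, ∀ x ∈ X, ⟪g x, x - xs⟫ = 0 → x ∈ S) (hrec : Reciprocity X S)
    {γ : ℕ → ℝ} (hγ0 : ∀ n, 0 ≤ γ n) (hγ : Tendsto γ atTop (𝓝 0))
    (hγsum : Tendsto (fun N => ∑ n ∈ Finset.range N, γ n) atTop atTop)
    {z v : ℕ → E d} (hz : ∀ n, z (n + 1) = z n - γ n • v n)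
    (hv : Tendsto (fun n => v n - g (proj X (z n))) atTop (𝓝 0)) :
    Tendsto (fun n => Metric.infDist (proj X (z n)) S) atTop (𝓝 0) := by
  obtain ⟨G, hG⟩ := hK.exists_bound_of_continuousOn hg
  obtain ⟨R, hR⟩ := Metric.isBounded_iff.1 hK.isBounded
  have hSK := hK.of_isClosed_subset hS hSX
  have hp : ∀ n, proj X (z n) ∈ X := fun n => proj_mem hne hK _
  set β : ℕ → ℝ := fun n => ‖v n - g (proj X (z n))‖ with hβ
  -- The relative error of one step: replacing `v n` by `g` costs `β n` times the diameter bound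
  -- `R`, and the quadratic term is controlled by `‖v n‖ ≤ G + β n`.
  set η : ℕ → ℝ := fun n => 2 * β n * R + γ n * (G + β n) ^ 2 with hη
  have hβ0 : Tendsto β atTop (𝓝 0) := by simpa using hv.norm
  have hη0 : Tendsto η atTop (𝓝 0) := by
    have h1 := ((hβ0.const_mul 2).mul_const R).add (hγ.mul ((hβ0.const_add G).pow 2))
    simpa using h1
  have hdesc : ∀ n r, (∀ xs ∈ S, r ≤ ⟪g (proj X (z n)), proj X (z n) - xs⟫) →
      energy X S (z (n + 1)) ≤ energy X S (z n) - γ n * (2 * r - η n) := by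
    intro n r hr
    rw [hz]
    refine energy_sub_le hne hK hc hSX hSne fun xs hxs => ?_
    have h1 := hr xs hxs
    have h2 : -(β n * R) ≤ ⟪v n - g (proj X (z n)), proj X (z n) - xs⟫ := by
      refine (neg_le_neg ?_).trans (neg_le_of_abs_le (abs_real_inner_le_norm _ _))
      refine mul_le_mul_of_nonneg_left ?_ (norm_nonneg _)
      rw [← dist_eq_norm]
      exact hR (hp n) (hSX hxs)
    have h3 : ‖v n‖ ≤ G + β n := by
      have := norm_add_le (g (proj X (z n))) (v n - g (proj X (z n)))
      rw [add_sub_cancel] at this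
      exact this.trans (add_le_add (hG _ (hp n)) le_rfl)
    have h4 : ‖v n‖ ^ 2 ≤ (G + β n) ^ 2 := pow_le_pow_left₀ (norm_nonneg _) h3 2
    rw [inner_sub_left] at h2
    rw [real_inner_smul_left, norm_smul, mul_pow, Real.norm_of_nonneg (hγ0 n)]
    have h5 : γ n * (2 * r - η n) ≤
        γ n * (2 * ⟪v n, proj X (z n) - xs⟫ - γ n * ‖v n‖ ^ 2) := by
      refine mul_le_mul_of_nonneg_left ?_ (hγ0 n)
      have := mul_le_mul_of_nonneg_left h4 (hγ0 n)
      simp only [hη]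
      linarith
    linarith
  have hE0 : ∀ n, 0 ≤ energy X S (z n) := fun n =>
    (sq_nonneg _).trans (infDist_sq_le_energy hne hK hc hSX hSne _)
  have hE : Tendsto (fun n => energy X S (z n)) atTop (𝓝 0) := by
    refine tendsto_zero_of_decrease hE0 hγsum hγ0 (fun δ hδ => ?_) fun δ hδ => ?_
    · obtain ⟨ε, hε, hεE⟩ := hrec.exists_le_infDist hSne hδ
      obtain ⟨c, hc0, hcE⟩ := exists_pos_le_inner hK hSK hg hpos hcoh hε
      refine ⟨c, hc0, ?_⟩
      -- Once `η n ≤ c`, the gain `2 * c - η n` is at least `c`.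
      filter_upwards [hη0.eventually (ge_mem_nhds hc0)] with n hn hδn
      refine (hdesc n c fun xs hxs => hcE xs hxs _ (hp n) (hεE _ hδn)).trans ?_
      have := mul_le_mul_of_nonneg_left hn (hγ0 n)
      linarith
    · have h1 : Tendsto (fun n => γ n * η n) atTop (𝓝 0) := by simpa using hγ.mul hη0
      filter_upwards [h1.eventually (ge_mem_nhds hδ)] with n hn
      have := hdesc n 0 fun xs hxs => hpos xs hxs _ (hp n)
      linarith
  have h2 : Tendsto (fun n => Metric.infDist (proj X (z n)) S ^ 2) atTop (𝓝 0) :=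
    squeeze_zero (fun n => sq_nonneg _)
      (fun n => infDist_sq_le_energy hne hK hc hSX hSne (z n)) hE
  simpa [Real.sqrt_sq Metric.infDist_nonneg] using h2.sqrt

/-- Pathwise convergence of delayed descent, given that the accumulated noise converges. -/
theorem tendsto_infDist_of_delayed (hne : X.Nonempty) (hK : IsCompact X) (hc : Convex ℝ X)
    (hSX : S ⊆ X) (hSne : S.Nonempty) (hS : IsClosed S) {L : ℝ≥0} (hg : LipschitzOnWith L g X)
    (hpos : ∀ xs ∈ S, ∀ x ∈ X, 0 ≤ ⟪g x, x - xs⟫)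
    (hcoh : ∀ xs ∈ S, ∀ x ∈ X, ⟪g x, x - xs⟫ = 0 → x ∈ S) (hrec : Reciprocity X S)
    {s : ℕ → ℕ} {α : ℕ → ℝ} (hα : ∀ n, 0 < α (n + 1)) (hgood : GoodSteps s α)
    (hs_le : ∀ n, s n ≤ n) (hs : Tendsto s atTop atTop) {y u : ℕ → E d}
    (hy : ∀ n, y (n + 1) = y n - α (n + 1) • (g (proj X (y (s n))) + u n)) {M : E d}
    (hM : Tendsto (fun N => ∑ n ∈ Finset.range N, α (n + 1) • u n) atTop (𝓝 M)) :
    Tendsto (fun n => Metric.infDist (proj X (y n)) S) atTop (𝓝 0) := by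
  obtain ⟨G, hG⟩ := hK.exists_bound_of_continuousOn hg.continuousOn
  set m : ℕ → E d := fun N => ∑ n ∈ Finset.range N, α (n + 1) • u n with hm
  have hp : ∀ n, proj X (y n) ∈ X := fun n => proj_mem hne hK _
  -- Adding `m` cancels the noise, so the increments are bounded by `G` times the step sizes.
  have hsum : ∀ j n, j ≤ n → ‖(y n + m n) - (y j + m j)‖ ≤
      G * ∑ k ∈ Finset.Ioc j n, α k := by
    intro j n hjn
    induction n, hjn using Nat.le_induction with
    | base => simp
    | succ n hjn ih =>
      rw [Finset.sum_Ioc_succ_top (by omega), mul_add]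
      have h1 : y (n + 1) + m (n + 1) - (y j + m j) =
          (y n + m n - (y j + m j)) - α (n + 1) • g (proj X (y (s n))) := by
        simp only [hm, Finset.sum_range_succ, hy n, smul_add]
        abel
      rw [h1]
      refine (norm_sub_le _ _).trans (add_le_add ih ?_)
      rw [norm_smul, Real.norm_of_nonneg (hα n).le, mul_comm]
      exact mul_le_mul_of_nonneg_right (hG _ (hp _)) (hα n).le
  have hdelay : Tendsto (fun n => (y (s n) + m (s n)) - (y n + m n)) atTop (𝓝 0) := by
    refine squeeze_zero_norm (fun n => ?_)
      (by simpa using hgood.tendsto_delay.const_mul G)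
    rw [norm_sub_rev]
    exact hsum _ _ (hs_le n)
  have hnoise : Tendsto (fun n => m n - M) atTop (𝓝 0) := by simpa using hM.sub_const M
  have hyz : Tendsto (fun n => y (s n) - (y n + (m n - M))) atTop (𝓝 0) := by
    have := hdelay.sub (hnoise.comp hs)
    rw [sub_zero] at this
    refine this.congr fun n => ?_
    simp only [Function.comp_apply]
    abel
  -- The shift by the constant `M` makes this noise-free sequence asymptotic to `y` itself.
  have key : Tendsto (fun n => Metric.infDist (proj X (y n + (m n - M))) S) atTop (𝓝 0) := by
    refine tendsto_infDist_of_coherent hne hK hc hSX hSne hS hg.continuousOn hpos hcoh hrec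
      (γ := fun n => α (n + 1)) (fun n => (hα n).le) hgood.tendsto_zero hgood.tendsto_sum
      (v := fun n => g (proj X (y (s n)))) (fun n => ?_) ?_
    · simp only [hm, Finset.sum_range_succ, hy n, smul_add]
      abel
    · refine squeeze_zero_norm (a := fun n => L * ‖y (s n) - (y n + (m n - M))‖) (fun n => ?_)
        (by simpa using hyz.norm.const_mul (L : ℝ))
      refine (hg.norm_sub_le (hp _) (proj_mem hne hK _)).trans ?_
      exact mul_le_mul_of_nonneg_left (norm_proj_sub_proj_le hne hK hc _ _) L.coe_nonneg
  refine squeeze_zero (fun _ => Metric.infDist_nonneg)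
    (fun n => ?_) (by simpa using key.add hnoise.norm)
  refine (Metric.infDist_le_infDist_add_dist (y := proj X (y n + (m n - M)))).trans
    (add_le_add le_rfl ?_)
  rw [dist_eq_norm]
  refine (norm_proj_sub_proj_le hne hK hc _ _).trans_eq ?_
  rw [sub_add_cancel_left, norm_neg]

end Deterministic

/-! ### Continuity of the objective and existence of solutions. -/

section Objective

/-- The fundamental theorem of calculus along the segment. The gradient need not be continuous: if
its norm has infinite integral the bound is trivial, and otherwise the derivative is integrable. -/
theorem enorm_sub_le_lintegral_gradient {d : ℕ} {X : Set (E d)} {φ : E d → ℝ} {G : E d → E d}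
    (hG : ∀ x ∈ X, HasGradientWithinAt φ (G x) X x) {x y : E d}
    (hseg : ∀ t ∈ Icc (0 : ℝ) 1, AffineMap.lineMap y x t ∈ X)
    (hmeas : AEStronglyMeasurable (fun t : ℝ => G (AffineMap.lineMap y x t))
      (volume.restrict (Icc 0 1))) :
    ‖φ x - φ y‖ₑ ≤
      (∫⁻ t in Icc (0 : ℝ) 1, ‖G (AffineMap.lineMap y x t)‖ₑ) * ‖x - y‖ₑ := by
  rcases eq_or_ne x y with rfl | hxy
  · simp
  rcases eq_or_ne (∫⁻ t in Icc (0 : ℝ) 1, ‖G (AffineMap.lineMap y x t)‖ₑ) ⊤ with htop | htop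
  · rw [htop, ENNReal.top_mul (by simpa [sub_eq_zero] using hxy)]
    exact le_top
  have hint : IntegrableOn (fun t : ℝ => G (AffineMap.lineMap y x t)) (Icc 0 1) :=
    ⟨hmeas, htop.lt_top⟩
  have hint' : IntegrableOn (fun t : ℝ => ⟪G (AffineMap.lineMap y x t), x - y⟫) (Icc 0 1) :=
    hint.inner_const (x - y)
  have hderiv : ∀ t ∈ Icc (0 : ℝ) 1, HasDerivWithinAt (fun t : ℝ => φ (AffineMap.lineMap y x t))
      ⟪G (AffineMap.lineMap y x t), x - y⟫ (Icc 0 1) t := by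
    intro t ht
    have h1 := (hG _ (hseg t ht)).hasFDerivWithinAt
    have h2 : HasDerivWithinAt (fun t : ℝ => AffineMap.lineMap y x t) (x - y) (Icc 0 1) t :=
      AffineMap.hasDerivWithinAt_lineMap
    have h3 := h1.comp_hasDerivWithinAt t h2 hseg
    rw [InnerProductSpace.toDual_apply_apply] at h3
    exact h3
  have hFTC : ∫ t in (0 : ℝ)..1, ⟪G (AffineMap.lineMap y x t), x - y⟫ = φ x - φ y := by
    rw [intervalIntegral.integral_eq_sub_of_hasDeriv_right
      (f := fun t : ℝ => φ (AffineMap.lineMap y x t))]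
    · simp
    · rw [uIcc_of_le zero_le_one]
      exact fun t ht => (hderiv t ht).continuousWithinAt
    · intro t ht
      rw [min_eq_left zero_le_one, max_eq_right zero_le_one] at ht
      exact ((hderiv t (Ioo_subset_Icc_self ht)).hasDerivAt
        (Icc_mem_nhds ht.1 ht.2)).hasDerivWithinAt
    · rw [intervalIntegrable_iff_integrableOn_Icc_of_le zero_le_one]
      exact hint'
  rw [← hFTC, intervalIntegral.integral_of_le zero_le_one, ← integral_Icc_eq_integral_Ioc,
    ← lintegral_mul_const' _ _ enorm_ne_top]
  refine (enorm_integral_le_lintegral_enorm _).trans (lintegral_mono fun t => ?_)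
  rw [← ofReal_norm, ← ofReal_norm, ← ofReal_norm, ← ENNReal.ofReal_mul (norm_nonneg _)]
  exact ENNReal.ofReal_le_ofReal (norm_inner_le_norm _ _)

variable {d : ℕ} {Ξ : Type*} [MeasurableSpace Ξ] {P : Measure Ξ}
  {X : Set (E d)} {F : E d → Ξ → ℝ} {gradF : E d → Ξ → E d}

theorem SmoothWithMoments.exists_bound (hF : SmoothWithMoments P X F gradF) :
    ∃ C : ℝ≥0, ∀ x ∈ X, ∫⁻ ω, ‖gradF x ω‖ₑ ^ 2 ∂P ≤ C := by
  refine ⟨(⨆ x ∈ X, ∫⁻ ω, ‖gradF x ω‖ₑ ^ 2 ∂P).toNNReal, fun x hx => ?_⟩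
  rw [ENNReal.coe_toNNReal hF.second_moment.ne]
  exact le_iSup₂ (f := fun x (_ : x ∈ X) => ∫⁻ ω, ‖gradF x ω‖ₑ ^ 2 ∂P) x hx

theorem SmoothWithMoments.measurable_comp (hF : SmoothWithMoments P X F gradF) {T : Type*}
    [MeasurableSpace T] {x : T → E d} (hx : Measurable x) (hxX : ∀ t, x t ∈ X) :
    Measurable fun p : T × Ξ => gradF (x p.1) p.2 :=
  hF.measurable_grad.comp
    (((hx.comp measurable_fst).subtype_mk (h := fun p => hxX p.1)).prodMk measurable_snd)

theorem SmoothWithMoments.measurable (hF : SmoothWithMoments P X F gradF) {x : E d}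
    (hx : x ∈ X) : Measurable (gradF x) :=
  (hF.measurable_comp (T := Unit) (x := fun _ => x) measurable_const fun _ => hx).comp
    (measurable_const.prodMk measurable_id : Measurable fun ω : Ξ => ((), ω))

theorem SmoothWithMoments.memLp (hF : SmoothWithMoments P X F gradF) {x : E d}
    (hx : x ∈ X) : MemLp (gradF x) 2 P := by
  refine ⟨(hF.measurable hx).aestronglyMeasurable, ?_⟩
  rw [eLpNorm_lt_top_iff_lintegral_rpow_enorm_lt_top two_ne_zero ENNReal.ofNat_ne_top]
  obtain ⟨C, hC⟩ := hF.exists_bound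
  simpa using (hC x hx).trans_lt ENNReal.coe_lt_top

variable [IsProbabilityMeasure P]

theorem SmoothWithMoments.integrable_grad (hF : SmoothWithMoments P X F gradF) {x : E d}
    (hx : x ∈ X) : Integrable (gradF x) P :=
  (hF.memLp hx).integrable one_le_two

theorem SmoothWithMoments.integral_inner (hF : SmoothWithMoments P X F gradF) {x : E d}
    (hx : x ∈ X) (v : E d) : ∫ ω, ⟪gradF x ω, v⟫ ∂P = ⟪∫ ω, gradF x ω ∂P, v⟫ := by
  rw [real_inner_comm, ← _root_.integral_inner (hF.integrable_grad hx)]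
  simp_rw [real_inner_comm]

theorem le_one_add_sq (a : ℝ≥0∞) : a ≤ 1 + a ^ 2 := by
  rcases le_total a 1 with h | h
  · exact h.trans le_self_add
  · refine le_trans ?_ le_add_self
    simpa [sq] using mul_le_mul_right h a

/-- Integrating the segment bound over `ω` and exchanging the integrals leaves only first moments of
the gradient at fixed points, at most `1 + C`; no bound uniform in `x` for fixed `ω` is required. -/
theorem SmoothWithMoments.continuousOn_objective (hF : SmoothWithMoments P X F gradF)
    (hc : Convex ℝ X) : ContinuousOn (objective P F) X := by
  obtain ⟨C, hC⟩ := hF.exists_bound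
  refine LipschitzOnWith.continuousOn (K := 1 + C) fun x hx y hy => ?_
  -- Clamping `t` keeps the path in `X` for every real `t`, as measurability of `gradF` is given
  -- only over `X`.
  set ℓ : ℝ → E d := fun t => AffineMap.lineMap y x (projIcc 0 1 zero_le_one t : ℝ) with hℓ
  have hℓX : ∀ t, ℓ t ∈ X := fun t =>
    hc.lineMap_mem hy hx (projIcc 0 1 zero_le_one t).2
  have hℓm : Measurable ℓ := by
    have : Continuous ℓ := AffineMap.lineMap_continuous.comp
      (continuous_subtype_val.comp continuous_projIcc)
    exact this.measurable
  have hm : Measurable fun p : ℝ × Ξ => gradF (ℓ p.1) p.2 := hF.measurable_comp hℓm hℓX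
  have hℓeq : ∀ t ∈ Icc (0 : ℝ) 1, ℓ t = AffineMap.lineMap y x t := fun t ht => by
    simp only [hℓ, projIcc_of_mem zero_le_one ht]
  rw [edist_eq_enorm_sub, edist_eq_enorm_sub, objective, objective,
    ← integral_sub (hF.integrable x hx) (hF.integrable y hy)]
  refine (enorm_integral_le_lintegral_enorm _).trans ?_
  calc ∫⁻ ω, ‖F x ω - F y ω‖ₑ ∂P
      ≤ ∫⁻ ω, (∫⁻ t in Icc (0 : ℝ) 1, ‖gradF (ℓ t) ω‖ₑ) * ‖x - y‖ₑ ∂P := by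
        refine lintegral_mono_ae ?_
        filter_upwards [hF.differentiable] with ω hω
        have h1 : ∀ t ∈ Icc (0 : ℝ) 1, gradF (ℓ t) ω = gradF (AffineMap.lineMap y x t) ω :=
          fun t ht => by rw [hℓeq t ht]
        refine (enorm_sub_le_lintegral_gradient (G := fun x => gradF x ω) hω (x := x) (y := y)
          (fun t ht => hc.lineMap_mem hy hx ht) ?_).trans_eq ?_
        · refine (hm.comp (measurable_id.prodMk measurable_const :
            Measurable fun t : ℝ => (t, ω))).aestronglyMeasurable.congr ?_
          exact (ae_restrict_iff' measurableSet_Icc).2 (.of_forall h1)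
        · rw [setLIntegral_congr_fun measurableSet_Icc fun t ht => by rw [← h1 t ht]]
    _ = (∫⁻ t in Icc (0 : ℝ) 1, ∫⁻ ω, ‖gradF (ℓ t) ω‖ₑ ∂P) * ‖x - y‖ₑ := by
        rw [lintegral_mul_const' _ _ enorm_ne_top, lintegral_lintegral_swap]
        exact (hm.comp measurable_swap).enorm.aemeasurable
    _ ≤ (∫⁻ t in Icc (0 : ℝ) 1, (1 + C : ℝ≥0∞)) * ‖x - y‖ₑ := by
        refine mul_le_mul_left (lintegral_mono fun t => ?_) _
        refine (lintegral_mono fun ω => le_one_add_sq ‖gradF (ℓ t) ω‖ₑ).trans ?_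
        rw [lintegral_add_left measurable_const]
        simpa using hC _ (hℓX t)
    _ = _ := by simp

theorem SmoothWithMoments.solutionSet_nonempty (hF : SmoothWithMoments P X F gradF)
    (hne : X.Nonempty) (hK : IsCompact X) (hc : Convex ℝ X) : (solutionSet P F X).Nonempty := by
  obtain ⟨x, hx, hmin⟩ := hK.exists_isMinOn hne (hF.continuousOn_objective hc)
  exact ⟨x, hx, fun z hz => hmin hz⟩

theorem SmoothWithMoments.isClosed_solutionSet (hF : SmoothWithMoments P X F gradF)
    (hK : IsCompact X) (hc : Convex ℝ X) : IsClosed (solutionSet P F X) := by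
  rcases (solutionSet P F X).eq_empty_or_nonempty with h | ⟨x, hx, hmin⟩
  · rw [h]
    exact isClosed_empty
  · have : solutionSet P F X = X ∩ objective P F ⁻¹' Iic (objective P F x) :=
      Set.ext fun z => ⟨fun hz => ⟨hz.1, hz.2 x hx⟩,
        fun hz => ⟨hz.1, fun w hw => le_trans hz.2 (hmin w hw)⟩⟩
    rw [this]
    exact (hF.continuousOn_objective hc).preimage_isClosed_of_isClosed hK.isClosed isClosed_Iic

end Objective

/-! ### Convergence of square-summable martingale sums. -/

section Martingale

/-- Sums of orthogonal martingale differences with summable variances converge almost surely. -/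
theorem ae_exists_tendsto_sum_of_orthogonal {Ω : Type*} [mΩ : MeasurableSpace Ω] {μ : Measure Ω}
    [IsProbabilityMeasure μ] (ℱ : Filtration ℕ mΩ) {D : ℕ → Ω → ℝ}
    (hD : ∀ n, StronglyMeasurable[ℱ (n + 1)] (D n)) (hL2 : ∀ n, MemLp (D n) 2 μ)
    (horth : ∀ n (Φ : Ω → ℝ), StronglyMeasurable[ℱ n] Φ → MemLp Φ 2 μ →
      ∫ w, Φ w * D n w ∂μ = 0)
    (hsum : Summable fun n => ∫ w, D n w ^ 2 ∂μ) :
    ∀ᵐ w ∂μ, ∃ l, Tendsto (fun N => ∑ n ∈ Finset.range N, D n w) atTop (𝓝 l) := by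
  set M : ℕ → Ω → ℝ := fun N w => ∑ n ∈ Finset.range N, D n w with hM
  have hML2 : ∀ N, MemLp (M N) 2 μ := fun N => memLp_finsetSum _ fun n _ => hL2 n
  have hMad : ∀ N, StronglyMeasurable[ℱ N] (M N) := fun N =>
    Finset.stronglyMeasurable_fun_sum _ fun n hn =>
      (hD n).mono (ℱ.mono (Nat.succ_le_of_lt (Finset.mem_range.1 hn)))
  have hMsucc : ∀ N w, M (N + 1) w = M N w + D N w := fun N w => Finset.sum_range_succ _ _
  have hmart : Martingale M ℱ μ := by
    refine martingale_of_setIntegral_eq_succ hMad (fun N => (hML2 N).integrable one_le_two)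
      fun N A hA => ?_
    -- Testing with indicators of past events gives the martingale property; testing with `M N`
    -- below gives additivity of the variances.
    have h1 := horth N (A.indicator 1) (stronglyMeasurable_one.indicator hA)
      ((memLp_const (1 : ℝ)).indicator (ℱ.le N _ hA))
    simp_rw [hMsucc]
    rw [integral_add ((hML2 N).integrable one_le_two).integrableOn
      ((hL2 N).integrable one_le_two).integrableOn]
    have h2 : ∫ w in A, D N w ∂μ = 0 := by
      rw [← h1, ← integral_indicator (ℱ.le N _ hA)]
      refine integral_congr_ae (.of_forall fun w => ?_)
      by_cases hw : w ∈ A <;> simp [hw]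
    rw [h2, add_zero]
  have hvar : ∀ N, ∫ w, M N w ^ 2 ∂μ = ∑ n ∈ Finset.range N, ∫ w, D n w ^ 2 ∂μ := by
    intro N
    induction N with
    | zero => simp [hM]
    | succ N ih =>
      have h1 := horth N (M N) (hMad N) (hML2 N)
      have h2 : Integrable (fun w => M N w * D N w) μ := (hML2 N).integrable_mul (hL2 N)
      have h3 : ∀ w, M (N + 1) w ^ 2 = (M N w ^ 2 + 2 * (M N w * D N w)) + D N w ^ 2 := fun w => by
        rw [hMsucc]
        ring
      have h4 : Integrable (fun w => M N w ^ 2 + 2 * (M N w * D N w)) μ :=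
        (hML2 N).integrable_sq.add (h2.const_mul 2)
      simp_rw [h3]
      rw [integral_add h4 (hL2 N).integrable_sq,
        integral_add (hML2 N).integrable_sq (h2.const_mul 2), integral_const_mul, h1,
        Finset.sum_range_succ, ih]
      ring
  -- The martingale convergence theorem needs only an `L¹` bound, which follows from `|a| ≤ 1 + a ^
  -- 2`.
  have hbound : ∀ N, eLpNorm (M N) 1 μ ≤
      ((1 + ∑' n, ∫ w, D n w ^ 2 ∂μ).toNNReal : ℝ≥0∞) := by
    intro N
    rw [eLpNorm_one_eq_lintegral_enorm,
      ← ofReal_integral_norm_eq_lintegral_enorm ((hML2 N).integrable one_le_two)]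
    refine ENNReal.ofReal_le_ofReal ?_
    have h1 : ∫ w, ‖M N w‖ ∂μ ≤ ∫ w, (1 + M N w ^ 2) ∂μ := by
      refine integral_mono ((hML2 N).integrable one_le_two).norm
        ((integrable_const _).add (hML2 N).integrable_sq) fun w => ?_
      simp only [Real.norm_eq_abs]
      nlinarith [sq_nonneg (|M N w| - 1), sq_abs (M N w), abs_nonneg (M N w)]
    rw [integral_add (integrable_const _) (hML2 N).integrable_sq, hvar] at h1
    have h2 := hsum.sum_le_tsum (Finset.range N)
      fun n _ => integral_nonneg fun w => sq_nonneg (D n w)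
    simp only [integral_const, probReal_univ, smul_eq_mul, mul_one] at h1
    linarith
  filter_upwards [hmart.submartingale.ae_tendsto_limitProcess hbound] with w hw
  exact ⟨_, hw⟩

end Martingale

/-! ### Independence of the past and convergence of the gradient noise. -/

section Noise

variable {Ω Ξ : Type*} [mΩ : MeasurableSpace Ω] [mΞ : MeasurableSpace Ξ] {μ : Measure Ω}
  {P : Measure Ξ} {ω : ℕ → Ω → Ξ}

/-- The information in the first `n` samples. -/
def IsIIDSample.past (hω : IsIIDSample μ P ω) : Filtration ℕ mΩ where
  seq n := ⨆ j ∈ Iio n, mΞ.comap (ω (j + 1))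
  mono' _ _ h := biSup_mono fun _ hj => lt_of_lt_of_le hj h
  le' _ := iSup₂_le fun j _ => (hω.measurable j).comap_le

theorem IsIIDSample.measurable_past (hω : IsIIDSample μ P ω) (n : ℕ) :
    Measurable[hω.past (n + 1)] (ω (n + 1)) :=
  Measurable.of_comap_le (le_iSup₂_of_le (f := fun j (_ : j ∈ Iio (n + 1)) => mΞ.comap (ω (j + 1)))
    n (Nat.lt_succ_self n) le_rfl)

theorem IsIIDSample.indepFun (hω : IsIIDSample μ P ω) {T : Type*} [mT : MeasurableSpace T] {n : ℕ}
    {τ : Ω → T} (hτ : Measurable[hω.past n] τ) : IndepFun τ (ω (n + 1)) μ := by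
  have h := indep_iSup_of_disjoint (fun j => (hω.measurable j).comap_le) hω.indep.iIndep
    (S := Iio n) (T := {n}) (by simp)
  refine indep_of_indep_of_le_left (indep_of_indep_of_le_right h ?_) hτ.comap_le
  simp

variable [IsProbabilityMeasure μ]

theorem IsIIDSample.map_prod (hω : IsIIDSample μ P ω) {T : Type*} [MeasurableSpace T] {n : ℕ}
    {τ : Ω → T} (hτ : Measurable[hω.past n] τ) :
    μ.map (fun w => (τ w, ω (n + 1) w)) = (μ.map τ).prod P := by
  rw [(indepFun_iff_map_prod_eq_prod_map_map ((hτ.mono (hω.past.le n) le_rfl).aemeasurable)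
    (hω.measurable n).aemeasurable).1 (hω.indepFun hτ), hω.law]

variable [IsProbabilityMeasure P]

theorem IsIIDSample.lintegral_eq (hω : IsIIDSample μ P ω) {T : Type*} [MeasurableSpace T] {n : ℕ}
    {τ : Ω → T} (hτ : Measurable[hω.past n] τ) {H : T × Ξ → ℝ≥0∞} (hH : Measurable H) :
    ∫⁻ w, H (τ w, ω (n + 1) w) ∂μ = ∫⁻ w, ∫⁻ x, H (τ w, x) ∂P ∂μ := by
  have hτ' := hτ.mono (hω.past.le n) le_rfl
  rw [← lintegral_map hH (hτ'.prodMk (hω.measurable n)), hω.map_prod hτ,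
    lintegral_prod _ hH.aemeasurable, lintegral_map hH.lintegral_prod_right' hτ']

/-- By independence the joint law is a product, so Fubini integrates the fresh sample first with the
past frozen. This takes the place of a conditional expectation. -/
theorem IsIIDSample.integral_eq_zero (hω : IsIIDSample μ P ω) {T : Type*} [MeasurableSpace T]
    {n : ℕ} {τ : Ω → T} (hτ : Measurable[hω.past n] τ) {H : T × Ξ → ℝ} (hH : Measurable H)
    (hint : Integrable (fun w => H (τ w, ω (n + 1) w)) μ) (h0 : ∀ t, ∫ x, H (t, x) ∂P = 0) :
    ∫ w, H (τ w, ω (n + 1) w) ∂μ = 0 := by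
  have hτ' := hτ.mono (hω.past.le n) le_rfl
  have hm := hτ'.prodMk (hω.measurable n)
  have : IsProbabilityMeasure (μ.map τ) := Measure.isProbabilityMeasure_map hτ'.aemeasurable
  rw [← integral_map hm.aemeasurable hH.aestronglyMeasurable, hω.map_prod hτ, integral_prod]
  · simp [h0]
  · rw [← hω.map_prod hτ]
    exact (integrable_map_measure hH.aestronglyMeasurable hm.aemeasurable).2 hint

variable {d : ℕ} {X : Set (E d)} {F : E d → Ξ → ℝ} {gradF : E d → Ξ → E d}

/-- The accumulated gradient noise converges almost surely. -/
theorem ae_exists_tendsto_noise (hF : SmoothWithMoments P X F gradF) (hK : IsCompact X)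
    (hω : IsIIDSample μ P ω) {x : ℕ → Ω → E d} (hx : ∀ n, Measurable[hω.past n] (x n))
    (hxX : ∀ n w, x n w ∈ X) {γ : ℕ → ℝ} (hγ : Summable fun n => γ n ^ 2) :
    ∀ᵐ w ∂μ, ∃ M : E d, Tendsto (fun N => ∑ n ∈ Finset.range N,
      γ n • (gradF (x n w) (ω (n + 1) w) - ∫ a, gradF (x n w) a ∂P)) atTop (𝓝 M) := by
  obtain ⟨C, hC⟩ := hF.exists_bound
  obtain ⟨L, hL⟩ := hF.lipschitz
  set g : E d → E d := fun x => ∫ a, gradF x a ∂P with hg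
  obtain ⟨G, hG⟩ := hK.exists_bound_of_continuousOn hL.continuousOn
  have hgm : Measurable fun x : X => g x :=
    (continuousOn_iff_continuous_domRestrict.1 hL.continuousOn).measurable
  let τ : ℕ → Ω → X := fun n w => ⟨x n w, hxX n w⟩
  have hτ : ∀ n, Measurable[hω.past n] (τ n) := fun n => (hx n).subtype_mk
  let h : X × Ξ → E d := fun p => gradF p.1 p.2 - g p.1
  have hh : Measurable h := hF.measurable_grad.sub (hgm.comp measurable_fst)
  have hgradm : ∀ n, Measurable[hω.past (n + 1)] fun w => gradF (x n w) (ω (n + 1) w) := fun n =>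
    hF.measurable_grad.comp
      (((hτ n).mono (hω.past.mono n.le_succ) le_rfl).prodMk (hω.measurable_past n))
  have hUm : ∀ n, Measurable[hω.past (n + 1)] fun w => h (τ n w, ω (n + 1) w) := fun n =>
    hh.comp (((hτ n).mono (hω.past.mono n.le_succ) le_rfl).prodMk (hω.measurable_past n))
  have hgrad_sq : ∀ n, ∫⁻ w, ‖gradF (x n w) (ω (n + 1) w)‖ₑ ^ 2 ∂μ ≤ C := fun n => by
    have h1 := hω.lintegral_eq (hτ n) (H := fun p => ‖gradF p.1 p.2‖ₑ ^ 2)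
      (hF.measurable_grad.enorm.pow_const 2)
    refine h1.trans_le ((lintegral_mono fun w => hC _ (hxX n w)).trans_eq ?_)
    simp
  have hgradL2 : ∀ n, MemLp (fun w => gradF (x n w) (ω (n + 1) w)) 2 μ := fun n => by
    refine ⟨((hgradm n).mono (hω.past.le _) le_rfl).aestronglyMeasurable, ?_⟩
    rw [eLpNorm_lt_top_iff_lintegral_rpow_enorm_lt_top two_ne_zero ENNReal.ofNat_ne_top]
    simpa using (hgrad_sq n).trans_lt ENNReal.coe_lt_top
  have hgL2 : ∀ n, MemLp (fun w => g (x n w)) 2 μ := fun n =>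
    MemLp.of_bound ((hgm.comp ((hτ n).mono (hω.past.le _) le_rfl)).aestronglyMeasurable) G
      (.of_forall fun w => hG _ (hxX n w))
  have hUL2 : ∀ n, MemLp (fun w => h (τ n w, ω (n + 1) w)) 2 μ := fun n =>
    (hgradL2 n).sub (hgL2 n)
  have hU_sq : ∀ n, ∫ w, ‖h (τ n w, ω (n + 1) w)‖ ^ 2 ∂μ ≤ 2 * C + 2 * G ^ 2 := fun n => by
    have h1 : ∫ w, ‖gradF (x n w) (ω (n + 1) w)‖ ^ 2 ∂μ ≤ C := by
      rw [integral_eq_lintegral_of_nonneg_ae (.of_forall fun w => sq_nonneg _)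
        (hgradL2 n).norm.integrable_sq.aestronglyMeasurable]
      refine ENNReal.toReal_le_of_le_ofReal C.coe_nonneg ?_
      simpa [ENNReal.ofReal_pow] using hgrad_sq n
    calc ∫ w, ‖h (τ n w, ω (n + 1) w)‖ ^ 2 ∂μ
        ≤ ∫ w, (2 * ‖gradF (x n w) (ω (n + 1) w)‖ ^ 2 + 2 * G ^ 2) ∂μ := by
          refine integral_mono (hUL2 n).norm.integrable_sq
            (((hgradL2 n).norm.integrable_sq.const_mul 2).add (integrable_const _))
            fun w => ?_
          have h2 := norm_sub_le (gradF (x n w) (ω (n + 1) w)) (g (x n w))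
          have h3 := pow_le_pow_left₀ (norm_nonneg _) (h2.trans (add_le_add le_rfl
            (hG _ (hxX n w)))) 2
          refine h3.trans ?_
          nlinarith [sq_nonneg (‖gradF (x n w) (ω (n + 1) w)‖ - G)]
      _ ≤ _ := by
          rw [integral_add ((hgradL2 n).norm.integrable_sq.const_mul 2) (integrable_const _),
            integral_const_mul]
          simp only [integral_const, probReal_univ, smul_eq_mul, one_mul]
          linarith
  -- Convergence is proved for each of the finitely many coordinates, where the scalar martingale
  -- result applies.
  have hcoord : ∀ i : Fin d, ∀ᵐ w ∂μ, ∃ l, Tendsto (fun N => ∑ n ∈ Finset.range N,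
      γ n * h (τ n w, ω (n + 1) w) i) atTop (𝓝 l) := by
    intro i
    have hproj : Measurable fun v : E d => v i := by fun_prop
    have hcL2 : ∀ n, MemLp (fun w => h (τ n w, ω (n + 1) w) i) 2 μ := fun n =>
      (hUL2 n).mono (hproj.comp ((hUm n).mono (hω.past.le _) le_rfl)).aestronglyMeasurable
        (.of_forall fun w => PiLp.norm_apply_le _ i)
    refine ae_exists_tendsto_sum_of_orthogonal hω.past
      (fun n => ((hproj.comp (hUm n)).const_mul _).stronglyMeasurable)
      (fun n => (hcL2 n).const_mul _) (fun n Φ hΦ hΦL2 => ?_) ?_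
    -- The test function joins the frozen past, so orthogonality reduces to centring of `h` at each
    -- fixed point of `X`.
    · refine hω.integral_eq_zero (τ := fun w => (τ n w, Φ w)) ((hτ n).prodMk hΦ.measurable)
        (H := fun p => p.1.2 * (γ n * h (p.1.1, p.2) i)) ?_
        (hΦL2.integrable_mul ((hcL2 n).const_mul (γ n))) fun t => ?_
      · exact (measurable_snd.comp measurable_fst).mul ((hproj.comp (hh.comp
          ((measurable_fst.comp measurable_fst).prodMk measurable_snd))).const_mul _)
      · have h1 : ∫ a, h (t.1, a) i ∂P = 0 := by
          have h2 : Integrable (fun a => h (t.1, a)) P :=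
            (hF.integrable_grad t.1.2).sub (integrable_const (g t.1))
          have h3 : ∫ a, h (t.1, a) ∂P = 0 := by
            rw [integral_sub (hF.integrable_grad t.1.2) (integrable_const (g t.1))]
            simp [hg]
          have h4 := (EuclideanSpace.proj (𝕜 := ℝ) i).integral_comp_comm h2
          rw [h3, map_zero] at h4
          exact h4
        simp only [integral_const_mul, h1, mul_zero]
    · refine Summable.of_nonneg_of_le (fun n => integral_nonneg fun w => sq_nonneg _)
        (fun n => ?_) (hγ.mul_right (2 * (C : ℝ) + 2 * G ^ 2))
      simp_rw [mul_pow]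
      rw [integral_const_mul]
      refine mul_le_mul_of_nonneg_left (le_trans ?_ (hU_sq n)) (sq_nonneg _)
      refine integral_mono (hcL2 n).integrable_sq (hUL2 n).norm.integrable_sq fun w => ?_
      rw [← sq_abs, ← Real.norm_eq_abs]
      exact pow_le_pow_left₀ (norm_nonneg _) (PiLp.norm_apply_le _ i) 2
  filter_upwards [ae_all_iff.2 hcoord] with w hw
  choose l hl using hw
  refine ⟨WithLp.toLp 2 l, ?_⟩
  have h1 := ((PiLp.continuous_toLp 2 fun _ : Fin d => ℝ).tendsto l).comp (tendsto_pi_nhds.2 hl)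
  refine h1.congr fun N => ?_
  ext i
  simp [h, τ, g]

end Noise

/-! ### Adaptedness of the iterates and the final assembly. -/

theorem IsDASGD.measurable_past {d : ℕ} {Ω Ξ : Type*} [MeasurableSpace Ω] [MeasurableSpace Ξ]
    {μ : Measure Ω} {P : Measure Ξ} {X : Set (E d)} (hne : X.Nonempty) (hK : IsCompact X)
    (hc : Convex ℝ X) {F : E d → Ξ → ℝ} {gradF : E d → Ξ → E d}
    (hF : SmoothWithMoments P X F gradF) {s : ℕ → ℕ} (hs : ∀ n, s n ≤ n) {α : ℕ → ℝ}
    {ω : ℕ → Ω → Ξ} (hω : IsIIDSample μ P ω) {y₀ : E d} {Xs Ys : ℕ → Ω → E d}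
    (halg : IsDASGD X gradF s α y₀ ω Xs Ys) (n : ℕ) : Measurable[hω.past n] (Ys n) := by
  -- Strong induction, since a step may call on any earlier iterate `s n ≤ n`.
  induction n using Nat.strong_induction_on with
  | _ n ih =>
    cases n with
    | zero =>
      rw [funext halg.init]
      exact measurable_const
    | succ n =>
      have h1 : Measurable[hω.past (n + 1)] (Xs (s n)) := by
        rw [funext (halg.project (s n))]
        exact (continuous_proj hne hK hc).measurable.comp
          ((ih _ (Nat.lt_succ_of_le (hs n))).mono
            (hω.past.mono ((hs n).trans n.le_succ)) le_rfl)
      have h2 : Measurable[hω.past (n + 1)] fun w => gradF (Xs (s n) w) (ω (n + 1) w) :=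
        hF.measurable_grad.comp ((h1.subtype_mk (h := fun w => by
          rw [halg.project]
          exact proj_mem hne hK _)).prodMk (hω.measurable_past n))
      rw [funext (halg.step n)]
      exact ((ih n n.lt_succ_self).mono (hω.past.mono n.le_succ) le_rfl).sub (h2.const_smul (α (n + 1)))

end DASGD

theorem mainTheorem1 {d : ℕ} {Ω Ξ : Type*} [MeasurableSpace Ω] [MeasurableSpace Ξ]
    (μ : Measure Ω) [IsProbabilityMeasure μ] (P : Measure Ξ) [IsProbabilityMeasure P]
    (X : Set (DASGD.E d)) (hX_nonempty : X.Nonempty) (hX_compact : IsCompact X)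
    (hX_convex : Convex ℝ X)
    (F : DASGD.E d → Ξ → ℝ) (gradF : DASGD.E d → Ξ → DASGD.E d)
    (hF : DASGD.SmoothWithMoments P X F gradF)
    (hVC : DASGD.VariationallyCoherent P X F gradF)
    (s dl : ℕ → ℕ) (hs : DASGD.IsDelaySchedule s dl)
    (α : ℕ → ℝ) (hα : ∀ n, 0 < α (n + 1))
    (hregime : DASGD.DelayStepRegime dl α)
    (hrec : DASGD.Reciprocity X (DASGD.solutionSet P F X))
    (ω : ℕ → Ω → Ξ) (hω : DASGD.IsIIDSample μ P ω)
    (y₀ : DASGD.E d) (Xs Ys : ℕ → Ω → DASGD.E d)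
    (halg : DASGD.IsDASGD X gradF s α y₀ ω Xs Ys) :
    ∀ᵐ w ∂μ, DASGD.ConvergesToSet (fun n => Xs n w) (DASGD.solutionSet P F X) := by
  open DASGD in
  have hgood := hregime.goodSteps hs hα
  have hSne := hF.solutionSet_nonempty hX_nonempty hX_compact hX_convex
  obtain ⟨L, hL⟩ := hF.lipschitz
  have hXs : ∀ n w, Xs n w ∈ X := fun n w => by
    rw [halg.project]
    exact proj_mem hX_nonempty hX_compact _
  have hm : ∀ n, Measurable[hω.past n] (Xs (s n)) := fun n => by
    rw [funext (halg.project (s n))]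
    exact (continuous_proj hX_nonempty hX_compact hX_convex).measurable.comp
      ((halg.measurable_past hX_nonempty hX_compact hX_convex hF hs.le_self hω (s n)).mono
        (hω.past.mono (hs.le_self n)) le_rfl)
  -- Noise is indexed by arrival: `ω (n + 1)` is fresh relative to `Xs (s n)` because `s n ≤ n`.
  filter_upwards [ae_exists_tendsto_noise hF hX_compact hω hm (fun n => hXs (s n))
    hgood.summable_sq] with w ⟨M, hM⟩
  rw [convergesToSet_iff hSne]
  simp_rw [halg.project]
  refine tendsto_infDist_of_delayed hX_nonempty hX_compact hX_convex (fun x hx => hx.1) hSne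
    (hF.isClosed_solutionSet hX_compact hX_convex) hL (fun xs hxs x hx => ?_)
    (fun xs hxs x hx h => ?_) hrec hα hgood hs.le_self hs.tendsto (fun n => ?_) hM
  · rw [← hF.integral_inner hx]
    exact (hVC xs hxs x hx).1
  · rw [← hF.integral_inner hx] at h
    exact (hVC xs hxs x hx).2 h
  · rw [halg.step, ← halg.project, add_sub_cancel]
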